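/- **Setting.** Let $B_\infty$ be the braid group with generators $\sigma_i$ ($i\ge 1$) and relations $\sigma_i\sigma_j=\sigma_j\sigma_i$ ($|i-j|\ge 2$), $\sigma_i\sigma_j\sigma_i=\sigma_j\sigma_i\sigma_j$ ($|i-j|=1$). Let $\partial$ be the shift endomorphism $\sigma_i\mapsto\sigma_{i+1}$, and let $B_n=\langle\sigma_1,\dots,\sigma_{n-1}\rangle\le B_\infty$. Put $\delta_n=\sigma_{n-1}\cdots\sigma_1$ and $\tau_{p,q}=\delta_{p+1}\,\partial(\delta_{p+1})\cdots\partial^{q-1}(\delta_{p+1})$. Fix integers $1<q_1<q_2<p$ with $q_1\ge 3$ and $p-q_2\ge 3$. For $\epsilon\in\{\pm1\}^k$ let $$\tau(p,\epsilon)=\tau_{p,p}^{\epsilon_k}\,\partial^p(\tau_{p,p}^{\epsilon_{k-1}})\cdots\partial^{(k-1)p}(\tau_{p,p}^{\epsilon_1}).$$ **(Modified) special decomposition problem.** A solution for a pair $(s,s')\in B_\infty^2$ consists of $k\in\mathbb N$, $\epsilon\in\{\pm1\}^k$, $b\in B_\infty$, $\beta'\in\partial^{q_2}(B_{p-q_2})$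 and $\beta''\in\prod_{j=1}^k\partial^{(j-1)p+q_1}(B_{p-q_1})$ such that $$s'=\partial^p(b^{-1})\,\beta'\,\partial^p(\beta'')\,\tau(p,\epsilon)\,\partial^{kp}(s)\,b .$$ The input is a pair $(s,s')$ that has a solution; the objective is to find one. The input has depth $k$ if it has a solution with this $k$. **Subgroup conjugacy coset problem (SCCP)** for subgroups $(H,K)$ of a group $G$. The input is a pair $(x,y)\in G^2$ such that the conjugacy class $x^G$ meets $Hy$; the objective is to find $h\in H$ and $c\in K$ with $cxc^{-1}=hy$. Braids are given as words in the $\sigma_i^{\pm1}$, and elements of a standard parabolic subgroup (one generated by a set of the $\sigma_i$) as words in its generators $\sigma_i^{\pm1}$. **Proposition.** For $k,N\in\mathbb N$ with $N\ge(k+1)p$ put $$H_{k,N}=\partial^{N-p+q_2}(B_{p-q_2})\cdot\prod_{j=1}^k\partial^{(j-1)p+q_1}(B_{p-q_1}),\qquad K_N=B_{N-p}.$$ These are standard parabolic subgroups of $B_N$. The special decomposition problem for inputs of depth $k$ can be solved by solving $2^k$ instances of the SCCP for $(H_{k,N},K_N)$ in $B_N$, for every sufficiently large $N$, in the following sense.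 There are primitive recursive maps $\mathrm{inst}$ and $\mathrm{dec}$ on words such that, for all $k$, all $N\ge(k+1)p$ and all words $s$ in $B_{N-kp}$ and $s'$ in $B_N$ (given $k,s,s'$, these conditions hold for all large $N$), the following holds. For each of the $2^k$ sign vectors $\epsilon\in\{\pm1\}^k$, $\mathrm{inst}(N,\epsilon,s,s')=(x_\epsilon,y_\epsilon)$ is a pair of words in $B_N$, and: 1. if $(h,c)$ is any solution of the SCCP for $(H_{k,N},K_N)$ and $(x_\epsilon,y_\epsilon)$, then $\mathrm{dec}(N,h,c)=(b,\beta',\beta'')$, together with $k$ and $\epsilon$, is a solution of the decomposition problem for $(s,s')$; 2. if the decomposition problem for $(s,s')$ has a solution with depth $k$ and sign vector $\epsilon$, then $(x_\epsilon,y_\epsilon)$ is an admissible input of this SCCP and has a solution. Consequently, if $(s,s')$ is an input of depth $k$ and a solution has been found of each of the $2^k$ instances that has one (with an arbitrary answer for each of the others), then for at least one $\epsilon$ the answer is a solution of the instance, and $\mathrm{dec}$ turns it into a solution of the decomposition problem for $(s,s')$ with sign vector $\epsilon$. -/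

import Mathlib

open scoped Pointwise

/-- The defining relators of the braid group on infinitely many strands. Generators are numbered
from `0`: the generator `i` is the one usually written `σ_{i+1}`. -/
def braidRels : Set (FreeGroup ℕ) :=
  {r | ∃ i j : ℕ, i + 2 ≤ j ∧
    r = FreeGroup.of i * FreeGroup.of j * (FreeGroup.of j * FreeGroup.of i)⁻¹} ∪
  {r | ∃ i : ℕ, r = FreeGroup.of i * FreeGroup.of (i + 1) * FreeGroup.of i *
    (FreeGroup.of (i + 1) * FreeGroup.of i * FreeGroup.of (i + 1))⁻¹}

/-- The braid group `B_∞`. -/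
abbrev BraidInf : Type := PresentedGroup braidRels

/-- The Artin generator `σ_{i+1}` of `B_∞`. -/
def sigma (i : ℕ) : BraidInf := PresentedGroup.of i

theorem sigma_comm {i j : ℕ} (h : i + 2 ≤ j) : sigma i * sigma j = sigma j * sigma i := by
  have h1 := PresentedGroup.one_of_mem (rels := braidRels) (Or.inl ⟨i, j, h, rfl⟩)
  rw [map_mul, map_inv, mul_inv_eq_one] at h1
  exact h1

theorem sigma_braid (i : ℕ) :
    sigma i * sigma (i + 1) * sigma i = sigma (i + 1) * sigma i * sigma (i + 1) := by
  have h1 := PresentedGroup.one_of_mem (rels := braidRels) (Or.inr ⟨i, rfl⟩)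
  rw [map_mul, map_inv, mul_inv_eq_one] at h1
  exact h1

/-- The shift endomorphism `∂` of `B_∞`, sending each generator to the next one. -/
def braidShift : Monoid.End BraidInf :=
  PresentedGroup.toGroup (f := fun i => sigma (i + 1)) (rels := braidRels) (by
    rintro r (⟨i, j, h, rfl⟩ | ⟨i, rfl⟩)
    · simp only [map_mul, map_inv, FreeGroup.lift_apply_of, mul_inv_eq_one]
      exact sigma_comm (by omega)
    · simp only [map_mul, map_inv, FreeGroup.lift_apply_of, mul_inv_eq_one]
      exact sigma_braid (i + 1))

/-- `B_n`, as the subgroup of `B_∞` generated by the first `n - 1` Artin generators. -/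
def braidGroup (n : ℕ) : Subgroup BraidInf :=
  Subgroup.closure (sigma '' {i | i + 1 < n})

/-- `∂^a(B_n)`. -/
def shiftedBraidGroup (a n : ℕ) : Subgroup BraidInf :=
  (braidGroup n).map (braidShift ^ a : Monoid.End BraidInf)

/-- A standard parabolic subgroup of `B_n`: one generated by a set of Artin generators of `B_n`. -/
def IsStandardParabolic (n : ℕ) (P : Subgroup BraidInf) : Prop :=
  ∃ S : Set ℕ, S ⊆ {i | i + 1 < n} ∧ P = Subgroup.closure (sigma '' S)

/-- `δ_n = σ_{n-1} ⋯ σ_2 σ_1`. -/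
def braidDelta (n : ℕ) : BraidInf :=
  ((List.range (n - 1)).reverse.map sigma).prod

/-- `τ_{p,q} = δ_{p+1} ∂(δ_{p+1}) ⋯ ∂^{q-1}(δ_{p+1})`. -/
def braidTau (p q : ℕ) : BraidInf :=
  ((List.range q).map fun j => (braidShift ^ j) (braidDelta (p + 1))).prod

/-- `τ(p,ε) = τ_{p,p}^{ε_k} ∂^p(τ_{p,p}^{ε_{k-1}}) ⋯ ∂^{(k-1)p}(τ_{p,p}^{ε_1})` for a sign vector
`ε ∈ {±1}^k`; `true` stands for `+1` and `false` for `-1`, and `ε_{i+1}` is `ε i`. -/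
def braidTauSigns (p : ℕ) {k : ℕ} (ε : Fin k → Bool) : BraidInf :=
  (List.ofFn fun i : Fin k =>
    (braidShift ^ ((i : ℕ) * p)) (braidTau p p ^ (if ε i.rev then (1 : ℤ) else -1))).prod

/-- The set `∏_{j=1}^{k} ∂^{(j-1)p+q₁}(B_{p-q₁})`: the elementwise product, in this order. -/
def blockProduct (p q₁ k : ℕ) : Set BraidInf :=
  (List.ofFn fun j : Fin k =>
    (shiftedBraidGroup ((j : ℕ) * p + q₁) (p - q₁) : Set BraidInf)).prod

/-- The subgroup generated by `∂^{(j-1)p+q₁}(B_{p-q₁})`, `j = 1, …, k`. -/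
def blockGroup (p q₁ k : ℕ) : Subgroup BraidInf :=
  ⨆ j : Fin k, shiftedBraidGroup ((j : ℕ) * p + q₁) (p - q₁)

/-- The subgroup generated by `∂^{N-p+q₂}(B_{p-q₂})` and `∂^{(j-1)p+q₁}(B_{p-q₁})`,
`j = 1, …, k`. -/
def cosetGroup (p q₁ q₂ k N : ℕ) : Subgroup BraidInf :=
  shiftedBraidGroup (N - p + q₂) (p - q₂) ⊔ blockGroup p q₁ k

/-! ### The special decomposition problem -/

/-- `(k, ε, b, β', β'')` is a solution of the (modified) special decomposition problem for the
pair `(s, s')`. -/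
def IsDecomposition (p q₁ q₂ : ℕ) (s s' : BraidInf) {k : ℕ} (ε : Fin k → Bool)
    (b β' β'' : BraidInf) : Prop :=
  β' ∈ shiftedBraidGroup q₂ (p - q₂) ∧ β'' ∈ blockProduct p q₁ k ∧
    s' = (braidShift ^ p) b⁻¹ * β' * (braidShift ^ p) β'' * braidTauSigns p ε *
      (braidShift ^ (k * p)) s * b

/-- `(s, s')` is an admissible input of the special decomposition problem, the unknown data having
depth `k`. -/
def IsDecompositionInput (p q₁ q₂ k : ℕ) (s s' : BraidInf) : Prop :=
  ∃ (ε : Fin k → Bool) (b β' β'' : BraidInf), IsDecomposition p q₁ q₂ s s' ε b β' β''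

/-! ### The subgroup conjugacy coset problem -/

/-- `(x, y)` is an admissible input of the subgroup conjugacy coset problem for `(H, K)` in `G`,
where `H, K ≤ G` and `G` is itself given as a subgroup of an ambient group: `x` and `y` lie in `G`
and the `G`-conjugacy class of `x` meets `H y`. -/
def IsSCCPInput {Γ : Type*} [Group Γ] (G H : Subgroup Γ) (x y : Γ) : Prop :=
  x ∈ G ∧ y ∈ G ∧ ∃ g ∈ G, ∃ h ∈ H, g * x * g⁻¹ = h * y

/-- `(h, c)` is a solution of the subgroup conjugacy coset problem for `(H, K)` and the
input `(x, y)`. -/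
def IsSCCPSolution {Γ : Type*} [Group Γ] (H K : Subgroup Γ) (x y h c : Γ) : Prop :=
  h ∈ H ∧ c ∈ K ∧ c * x * c⁻¹ = h * y

/-! ### Braid words -/

/-- Words in the Artin generators and their inverses: `(i, true)` is `σ_{i+1}` and `(i, false)`
is its inverse. -/
abbrev BraidWord : Type := List (ℕ × Bool)

/-- The braid represented by a word. -/
def BraidWord.eval (w : BraidWord) : BraidInf :=
  (w.map fun l => if l.2 then sigma l.1 else (sigma l.1)⁻¹).prod

/-- All letters of `w` are Artin generators belonging to `P`, or inverses of such. -/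
def BraidWord.IsIn (P : Subgroup BraidInf) (w : BraidWord) : Prop :=
  ∀ l ∈ w, sigma l.1 ∈ P

/-- The pair of words `a = (u, v)` represents a solution `(h, c)` of the subgroup conjugacy coset
problem for `(H, K)` and the input represented by the pair of words `i = (x, y)`; the element
`h` of `H` and the element `c` of `K` are written in the Artin generators of `H` and of `K`. -/
def SCCPAnswer (H K : Subgroup BraidInf) (i a : BraidWord × BraidWord) : Prop :=
  BraidWord.IsIn H a.1 ∧ BraidWord.IsIn K a.2 ∧
    IsSCCPSolution H K (BraidWord.eval i.1) (BraidWord.eval i.2)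
      (BraidWord.eval a.1) (BraidWord.eval a.2)

/-- The words `d = (b, β', β'')` represent, together with `k` and `ε`, a solution of the special
decomposition problem for the input represented by the words `w, w'`; `β'` and `β''` are written in
the Artin generators of the subgroups they have to belong to. -/
def DecompositionAnswer (p q₁ q₂ : ℕ) (w w' : BraidWord) {k : ℕ} (ε : Fin k → Bool)
    (d : BraidWord × BraidWord × BraidWord) : Prop :=
  BraidWord.IsIn (shiftedBraidGroup q₂ (p - q₂)) d.2.1 ∧ BraidWord.IsIn (blockGroup p q₁ k) d.2.2 ∧
    IsDecomposition p q₁ q₂ (BraidWord.eval w) (BraidWord.eval w') ε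
      (BraidWord.eval d.1) (BraidWord.eval d.2.1) (BraidWord.eval d.2.2)

/-! Put `m = N - p`. The braid `τ_{m,p}` passes a band of `m` strands across a band of `p` strands,
so it intertwines in two ways: `τ_{m,p} ∂^p(b) = b τ_{m,p}` for `b ∈ B_m`, and `τ_{m,p} b = ∂^m(b)
τ_{m,p}` for `b ∈ B_p` (`braidTau_mul_shift`, `braidTau_mul`).

For a sign vector `ε` take `x = τ_{m,p} s'` and `y = τ_{m,p} z` with `z = τ(p,ε) ∂^{kp}(s)`. For `c
∈ B_m` the first rule gives `c x c⁻¹ = τ_{m,p} ∂^p(c) s' c⁻¹`. For `h = ∂^m(β') β''`, both rules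
give `h y = τ_{m,p} β' ∂^p(β'') z`, since `β' ∈ B_p` and `β'' ∈ B_{kp} ≤ B_m`. Cancelling `τ_{m,p}`
turns `c x c⁻¹ = h y` into the decomposition equation with `b = c` (`conj_iff_decomposition`).
Decoding only separates the letters of `h` belonging to `β'` from those belonging to `β''`.

For the converse, the unknown `b ∈ B_∞` must be shown to lie in `B_m`
(`mem_braidGroup_of_twisted_conj`). The equation expresses `∂^p(b)` as a product of `b` and elements
of `B_N`. If `b ∈ B_{r+1}` with `r ≥ m`, then `∂^p(b) ∈ B_{r+p}`, hence `b ∈ B_r`, and one descends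
to `m`. This needs `∂⁻¹(B_{n+1}) ≤ B_n` (`mem_braidGroup_of_braidShift_mem`), which is proved by
forgetting a strand, using an action of `B_∞` on pairs of a marked position and a braid on the
remaining strands. -/

/-! ### The shift on generators. -/

theorem braidShift_pow_sigma (n i : ℕ) : (braidShift ^ n) (sigma i) = sigma (i + n) := by
  induction n with
  | zero => rfl
  | succ n ih =>
    rw [pow_succ', ← add_assoc]
    refine (congrArg braidShift ih).trans ?_
    exact PresentedGroup.toGroup.of _

theorem braidShift_sigma (i : ℕ) : braidShift (sigma i) = sigma (i + 1) := by
  simpa using braidShift_pow_sigma 1 i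

theorem braidShift_pow_add_apply (m n : ℕ) (b : BraidInf) :
    (braidShift ^ (m + n)) b = (braidShift ^ m) ((braidShift ^ n) b) := by
  rw [pow_add]; rfl

theorem sigma_commute {i j : ℕ} (h : i + 2 ≤ j ∨ j + 2 ≤ i) : Commute (sigma i) (sigma j) :=
  h.elim (fun h => sigma_comm h) fun h => (sigma_comm h).symm

/-! ### Words -/

namespace BraidWord

/-- The letterwise shift of a word. -/
def shift (n : ℕ) (w : BraidWord) : BraidWord := w.map fun l => (l.1 + n, l.2)

/-- The formal inverse of a word. -/
def inv (w : BraidWord) : BraidWord := (w.map fun l => (l.1, !l.2)).reverse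

@[simp] theorem eval_nil : eval [] = 1 := rfl

@[simp] theorem eval_cons (l : ℕ × Bool) (w : BraidWord) :
    eval (l :: w) = (if l.2 then sigma l.1 else (sigma l.1)⁻¹) * eval w := by
  simp [eval]

@[simp] theorem eval_append (v w : BraidWord) : eval (v ++ w) = eval v * eval w := by
  simp [eval]

theorem eval_shift (n : ℕ) (w : BraidWord) : eval (shift n w) = (braidShift ^ n) (eval w) := by
  induction w with
  | nil => simp [shift]
  | cons l w ih =>
    rw [shift, List.map_cons, eval_cons, eval_cons, map_mul, ← ih, shift]
    cases l.2 <;> simp only [Bool.false_eq_true, if_true, if_false, map_inv, braidShift_pow_sigma]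

theorem eval_inv (w : BraidWord) : eval (inv w) = (eval w)⁻¹ := by
  induction w with
  | nil => simp [inv]
  | cons l w ih =>
    rw [inv, List.map_cons, List.reverse_cons, eval_append, eval_cons l w, mul_inv_rev, ← ih, inv]
    cases l.2 <;> simp

theorem eval_flatMap {α : Type*} (l : List α) (f : α → BraidWord) :
    eval (l.flatMap f) = (l.map fun a => eval (f a)).prod := by
  induction l with
  | nil => rfl
  | cons a l ih => simp [ih]

theorem eval_mem {P : Subgroup BraidInf} {w : BraidWord} (h : IsIn P w) : eval w ∈ P := by
  induction w with
  | nil => exact P.one_mem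
  | cons l w ih =>
    rw [eval_cons]
    refine P.mul_mem ?_ (ih fun m hm => h m (List.mem_cons_of_mem _ hm))
    have := h l List.mem_cons_self
    split
    · exact this
    · exact P.inv_mem this

theorem exists_eval_eq {S : Set ℕ} {b : BraidInf} (hb : b ∈ Subgroup.closure (sigma '' S)) :
    ∃ w : BraidWord, (∀ l ∈ w, l.1 ∈ S) ∧ eval w = b := by
  induction hb using Subgroup.closure_induction with
  | mem x hx =>
    obtain ⟨i, hi, rfl⟩ := hx
    exact ⟨[(i, true)], by simpa using hi, by simp⟩
  | one => exact ⟨[], by simp, rfl⟩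
  | mul x y _ _ hx hy =>
    obtain ⟨v, hv, rfl⟩ := hx
    obtain ⟨w, hw, rfl⟩ := hy
    refine ⟨v ++ w, fun l hl => ?_, eval_append v w⟩
    exact (List.mem_append.1 hl).elim (hv l) (hw l)
  | inv x _ hx =>
    obtain ⟨v, hv, rfl⟩ := hx
    refine ⟨inv v, fun l hl => ?_, eval_inv v⟩
    simp only [inv, List.mem_reverse, List.mem_map] at hl
    obtain ⟨m, hm, rfl⟩ := hl
    exact hv m hm

theorem exists_isIn_eval_eq {S : Set ℕ} {b : BraidInf}
    (hb : b ∈ Subgroup.closure (sigma '' S)) :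
    ∃ w : BraidWord, IsIn (Subgroup.closure (sigma '' S)) w ∧ eval w = b := by
  obtain ⟨w, hw, rfl⟩ := exists_eval_eq hb
  exact ⟨w, fun l hl => Subgroup.subset_closure ⟨_, hw l hl, rfl⟩, rfl⟩

end BraidWord

theorem closure_sigma_univ : Subgroup.closure (sigma '' Set.univ) = ⊤ := by
  rw [Set.image_univ]
  exact PresentedGroup.closure_range_of braidRels

/-- Provides the starting level for the descents on the number of strands. -/
theorem exists_mem_braidGroup (b : BraidInf) : ∃ n, b ∈ braidGroup n := by
  obtain ⟨w, -, rfl⟩ := BraidWord.exists_eval_eq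
    (show b ∈ Subgroup.closure (sigma '' Set.univ) by rw [closure_sigma_univ]; trivial)
  -- The sum is a crude upper bound for every `l.1 + 2`.
  refine ⟨(w.map fun l => l.1 + 2).sum, BraidWord.eval_mem fun l hl =>
    Subgroup.subset_closure ⟨l.1, ?_, rfl⟩⟩
  exact Nat.lt_of_succ_le (List.le_sum_of_mem (List.mem_map_of_mem (f := fun l => l.1 + 2) hl))

theorem braidGroup_mono {m n : ℕ} (h : m ≤ n) : braidGroup m ≤ braidGroup n :=
  Subgroup.closure_mono (Set.image_mono fun i (hi : i + 1 < m) => lt_of_lt_of_le hi h)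

theorem sigma_mem_braidGroup {i n : ℕ} (h : i + 1 < n) : sigma i ∈ braidGroup n :=
  Subgroup.subset_closure ⟨i, h, rfl⟩

/-! ### Forgetting a strand -/

/-- The adjacent transposition `(j, j + 1)` on positions. -/
def adjSwap (j i : ℕ) : ℕ := if i = j then j + 1 else if i = j + 1 then j else i

/-- What remains of the generator `sigma j` when the strand starting at position `i` is removed. -/
def forgetSigma (j i : ℕ) : BraidInf :=
  if i < j then sigma (j - 1) else if i ≤ j + 1 then 1 else sigma j

theorem adjSwap_adjSwap (j i : ℕ) : adjSwap j (adjSwap j i) = i := by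
  unfold adjSwap; split_ifs <;> omega

theorem forgetSigma_adjSwap (j i : ℕ) : forgetSigma j (adjSwap j i) = forgetSigma j i := by
  unfold forgetSigma adjSwap; split_ifs <;> first | rfl | omega

/-- The action of a generator on pairs of a marked strand and a braid on the other strands. -/
def strandPerm (j : ℕ) : Equiv.Perm (ℕ × BraidInf) where
  toFun x := (adjSwap j x.1, forgetSigma j x.1 * x.2)
  invFun x := (adjSwap j x.1, (forgetSigma j x.1)⁻¹ * x.2)
  left_inv x := by simp [adjSwap_adjSwap, forgetSigma_adjSwap]
  right_inv x := by simp [adjSwap_adjSwap, forgetSigma_adjSwap]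

theorem strandPerm_comm {i j : ℕ} (h : i + 2 ≤ j) :
    strandPerm i * strandPerm j = strandPerm j * strandPerm i := by
  ext1 ⟨t, g⟩
  simp only [Equiv.Perm.mul_apply, strandPerm, Equiv.coe_fn_mk, Prod.mk.injEq, ← mul_assoc,
    mul_left_inj]
  constructor
  · unfold adjSwap; split_ifs <;> omega
  · unfold forgetSigma adjSwap
    split_ifs <;>
      first | omega | rfl | simp only [one_mul, mul_one] | exact sigma_comm (by omega)

theorem adjSwap_braid (i t : ℕ) :
    adjSwap i (adjSwap (i + 1) (adjSwap i t)) =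
      adjSwap (i + 1) (adjSwap i (adjSwap (i + 1) t)) := by
  unfold adjSwap; split_ifs <;> omega

theorem forgetSigma_of_lt {j i : ℕ} (h : i < j) : forgetSigma j i = sigma (j - 1) := if_pos h

theorem forgetSigma_of_gt {j i : ℕ} (h : j + 1 < i) : forgetSigma j i = sigma j := by
  rw [forgetSigma, if_neg (by omega), if_neg (by omega)]

theorem forgetSigma_self (j : ℕ) : forgetSigma j j = 1 := by simp [forgetSigma]

theorem forgetSigma_succ_self (j : ℕ) : forgetSigma j (j + 1) = 1 := by simp [forgetSigma]

theorem adjSwap_of_ne {j i : ℕ} (h : i ≠ j) (h' : i ≠ j + 1) : adjSwap j i = i := by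
  rw [adjSwap, if_neg h, if_neg h']

theorem adjSwap_self (j : ℕ) : adjSwap j j = j + 1 := by simp [adjSwap]

theorem adjSwap_succ_self (j : ℕ) : adjSwap j (j + 1) = j := by simp [adjSwap]

/-- If the marked strand is not one of the three involved, both sides keep three crossings and a
braid relation remains. If it is one of the three, a single crossing survives on each side, and it
is the same one. -/
theorem strandPerm_braid (i : ℕ) :
    strandPerm i * strandPerm (i + 1) * strandPerm i =
      strandPerm (i + 1) * strandPerm i * strandPerm (i + 1) := by
  ext1 ⟨t, g⟩
  simp only [Equiv.Perm.mul_apply, strandPerm, Equiv.coe_fn_mk, Prod.mk.injEq, ← mul_assoc,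
    mul_left_inj]
  refine ⟨adjSwap_braid i t, ?_⟩
  rcases lt_or_ge t i with h | h
  -- A position below `i` forces `i ≥ 1`, so the indices lowered by one obey a genuine braid
  -- relation.
  · obtain ⟨i, rfl⟩ : ∃ n, i = n + 1 := ⟨i - 1, by omega⟩
    rw [adjSwap_of_ne (j := i + 1) (i := t) (by omega) (by omega),
      adjSwap_of_ne (j := i + 1 + 1) (i := t) (by omega) (by omega),
      adjSwap_of_ne (j := i + 1) (i := t) (by omega) (by omega),
      forgetSigma_of_lt h, forgetSigma_of_lt (by omega)]
    exact sigma_braid i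
  rcases lt_or_ge (i + 2) t with h' | h'
  · rw [adjSwap_of_ne (j := i) (i := t) (by omega) (by omega),
      adjSwap_of_ne (j := i + 1) (i := t) (by omega) (by omega),
      adjSwap_of_ne (j := i) (i := t) (by omega) (by omega),
      forgetSigma_of_gt (by omega), forgetSigma_of_gt (by omega)]
    exact sigma_braid i
  · obtain rfl | rfl | rfl : t = i ∨ t = i + 1 ∨ t = i + 1 + 1 := by omega
    · have h1 : adjSwap (t + 1) t = t := adjSwap_of_ne (by omega) (by omega)
      have h2 : forgetSigma (t + 1) t = sigma t := forgetSigma_of_lt (by omega)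
      have h3 : forgetSigma t (t + 1 + 1) = sigma t := forgetSigma_of_gt (by omega)
      simp only [adjSwap_self, h1, h2, h3, forgetSigma_self, one_mul, mul_one]
    · have h1 : adjSwap (i + 1) i = i := adjSwap_of_ne (by omega) (by omega)
      have h2 : forgetSigma (i + 1) i = sigma i := forgetSigma_of_lt (by omega)
      have h3 : forgetSigma i (i + 1 + 1) = sigma i := forgetSigma_of_gt (by omega)
      have h4 : adjSwap i (i + 1 + 1) = i + 1 + 1 := adjSwap_of_ne (by omega) (by omega)
      simp only [adjSwap_self, adjSwap_succ_self, h1, h2, h3, h4, forgetSigma_self,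
        forgetSigma_succ_self, one_mul, mul_one]
    · have h2 : forgetSigma (i + 1) i = sigma i := forgetSigma_of_lt (by omega)
      have h3 : forgetSigma i (i + 1 + 1) = sigma i := forgetSigma_of_gt (by omega)
      have h4 : adjSwap i (i + 1 + 1) = i + 1 + 1 := adjSwap_of_ne (by omega) (by omega)
      simp only [adjSwap_succ_self, h2, h3, h4, forgetSigma_succ_self, one_mul, mul_one]

/-- The action of `B_∞` on pairs of a marked strand and a braid on the other strands. -/
def strandAction : BraidInf →* Equiv.Perm (ℕ × BraidInf) :=
  PresentedGroup.toGroup (f := strandPerm) (rels := braidRels) (by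
    rintro r (⟨i, j, h, rfl⟩ | ⟨i, rfl⟩)
    · simp only [map_mul, map_inv, FreeGroup.lift_apply_of, mul_inv_eq_one]
      exact strandPerm_comm h
    · simp only [map_mul, map_inv, FreeGroup.lift_apply_of, mul_inv_eq_one]
      exact strandPerm_braid i)

theorem strandAction_sigma (j : ℕ) (x : ℕ × BraidInf) :
    strandAction (sigma j) x = (adjSwap j x.1, forgetSigma j x.1 * x.2) := by
  rw [strandAction, sigma, PresentedGroup.toGroup.of]; rfl

theorem strandAction_sigma_inv (j : ℕ) (x : ℕ × BraidInf) :
    strandAction (sigma j)⁻¹ x = (adjSwap j x.1, (forgetSigma j x.1)⁻¹ * x.2) := by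
  rw [map_inv, strandAction, sigma, PresentedGroup.toGroup.of]; rfl

/-- Letters are added on the left because the leftmost letter acts last, on a pair already
controlled by the induction hypothesis. -/
theorem closure_sigma_induction {S : Set ℕ} {p : BraidInf → Prop} {b : BraidInf}
    (hb : b ∈ Subgroup.closure (sigma '' S)) (one : p 1)
    (sigma_mul : ∀ i ∈ S, ∀ b ∈ Subgroup.closure (sigma '' S), p b → p (sigma i * b))
    (inv_mul : ∀ i ∈ S, ∀ b ∈ Subgroup.closure (sigma '' S), p b → p ((sigma i)⁻¹ * b)) :
    p b := by
  induction hb using Subgroup.closure_induction_left with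
  | one => exact one
  | mul_left x hx y hy h => obtain ⟨i, hi, rfl⟩ := hx; exact sigma_mul i hi y hy h
  | inv_mul_cancel x hx y hy h => obtain ⟨i, hi, rfl⟩ := hx; exact inv_mul i hi y hy h

/-! ### Consequences of the strand action. -/

/-- Only `sigma i` and its inverse can carry a marked strand from position `i` or below to a
position above `i`. Membership of a generator in a parabolic subgroup thereby becomes a condition on
its index, as decoding words requires. -/
theorem sigma_mem_closure {S : Set ℕ} {i : ℕ} (h : sigma i ∈ Subgroup.closure (sigma '' S)) :
    i ∈ S := by
  by_contra hi
  have key : ∀ b ∈ Subgroup.closure (sigma '' S), (strandAction b (i, 1)).1 ≤ i := by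
    intro b hb
    refine closure_sigma_induction (p := fun b => (strandAction b (i, 1)).1 ≤ i) hb le_rfl ?_ ?_
    all_goals
      intro j hj b _ h
      have : j ≠ i := fun e => hi (e ▸ hj)
      rw [map_mul, Equiv.Perm.mul_apply]
      simp only [strandAction_sigma, strandAction_sigma_inv, adjSwap]
      split_ifs <;> omega
  have := key _ h
  simp [strandAction_sigma, adjSwap] at this

/-- A strand beyond the first `n` crosses nothing, so removing it changes neither its position nor
the braid. -/
theorem strandAction_of_le {n i : ℕ} (hi : n ≤ i) {b : BraidInf} (hb : b ∈ braidGroup n) :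
    strandAction b (i, 1) = (i, b) := by
  refine closure_sigma_induction (p := fun b => strandAction b (i, 1) = (i, b)) hb rfl ?_ ?_
  all_goals
    intro j (hj : j + 1 < n) b _ h
    rw [map_mul, Equiv.Perm.mul_apply, h]
    simp only [strandAction_sigma, strandAction_sigma_inv]
    rw [adjSwap, forgetSigma, if_neg (by omega), if_neg (by omega), if_neg (by omega),
      if_neg (by omega)]

theorem strandAction_mem {n i : ℕ} (hi : i < n + 1) {b : BraidInf} (hb : b ∈ braidGroup (n + 1)) :
    (strandAction b (i, 1)).1 < n + 1 ∧ (strandAction b (i, 1)).2 ∈ braidGroup n := by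
  have mem : ∀ j t : ℕ, j + 1 < n + 1 → t < n + 1 → forgetSigma j t ∈ braidGroup n := by
    intro j t hj ht
    unfold forgetSigma
    split_ifs
    · exact sigma_mem_braidGroup (by omega)
    · exact one_mem _
    · exact sigma_mem_braidGroup (by omega)
  have lt : ∀ j t : ℕ, j + 1 < n + 1 → t < n + 1 → adjSwap j t < n + 1 := by
    intro j t hj ht
    unfold adjSwap
    split_ifs <;> omega
  refine closure_sigma_induction (p := fun b =>
    (strandAction b (i, 1)).1 < n + 1 ∧ (strandAction b (i, 1)).2 ∈ braidGroup n) hb ⟨hi, one_mem _⟩ ?_ ?_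
  all_goals
    intro j (hj : j + 1 < n + 1) b _ h
    rw [map_mul, Equiv.Perm.mul_apply]
    simp only [strandAction_sigma, strandAction_sigma_inv]
  · exact ⟨lt _ _ hj h.1, mul_mem (mem _ _ hj h.1) h.2⟩
  · exact ⟨lt _ _ hj h.1, mul_mem (inv_mem (mem _ _ hj h.1)) h.2⟩

theorem braidShift_forgetSigma (j i : ℕ) :
    braidShift (forgetSigma j i) = forgetSigma (j + 1) (i + 1) := by
  unfold forgetSigma
  split_ifs <;> first | omega | simp only [map_one, braidShift_sigma]
  congr 1; omega

theorem adjSwap_succ_succ (j i : ℕ) : adjSwap (j + 1) (i + 1) = adjSwap j i + 1 := by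
  unfold adjSwap; split_ifs <;> omega

theorem mem_closure_sigma_univ (b : BraidInf) : b ∈ Subgroup.closure (sigma '' Set.univ) := by
  rw [closure_sigma_univ]; trivial

/-- Shifting adds an untouched strand on the left; forgetting another strand commutes with that. -/
theorem strandAction_braidShift (i : ℕ) (b : BraidInf) :
    strandAction (braidShift b) (i + 1, 1) =
      ((strandAction b (i, 1)).1 + 1, braidShift (strandAction b (i, 1)).2) := by
  refine closure_sigma_induction (p := fun b => strandAction (braidShift b) (i + 1, 1) =
      ((strandAction b (i, 1)).1 + 1, braidShift (strandAction b (i, 1)).2))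
    (mem_closure_sigma_univ b) (by simp) ?_ ?_
  all_goals
    intro j _ b _ h
    rw [map_mul, map_mul, map_mul, Equiv.Perm.mul_apply, Equiv.Perm.mul_apply, h]
    simp only [map_inv braidShift, braidShift_sigma]
    simp only [strandAction_sigma, strandAction_sigma_inv, adjSwap_succ_succ, map_mul,
      map_inv braidShift, braidShift_forgetSigma]

/-! ### The elements `δ` and `τ` -/

theorem braidDelta_one : braidDelta 1 = 1 := rfl

theorem braidDelta_succ (n : ℕ) : braidDelta (n + 2) = sigma n * braidDelta (n + 1) := by
  simp [braidDelta, List.range_succ]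

theorem braidDelta_mem (n : ℕ) : braidDelta n ∈ braidGroup n := by
  refine list_prod_mem fun x hx => ?_
  simp only [List.mem_map, List.mem_reverse, List.mem_range] at hx
  obtain ⟨i, hi, rfl⟩ := hx
  exact sigma_mem_braidGroup (by omega)

/-- Elements commuting with the generators of a subgroup, up to an endomorphism. -/
theorem mul_eq_mul_of_sigma {S : Set ℕ} {u : BraidInf} {f g : Monoid.End BraidInf}
    (h : ∀ i ∈ S, u * f (sigma i) = g (sigma i) * u) {b : BraidInf}
    (hb : b ∈ Subgroup.closure (sigma '' S)) : u * f b = g b * u := by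
  have key : Subgroup.closure (sigma '' S) ≤
      MonoidHom.eqLocus ((MulAut.conj u).toMonoidHom.comp f) g := by
    rw [Subgroup.closure_le]
    rintro _ ⟨i, hi, rfl⟩
    exact mul_inv_eq_of_eq_mul (h i hi)
  exact eq_mul_of_mul_inv_eq (key hb)

theorem commute_of_mem {S T : Set ℕ} (h : ∀ i ∈ S, ∀ j ∈ T, i + 2 ≤ j ∨ j + 2 ≤ i)
    {a b : BraidInf} (ha : a ∈ Subgroup.closure (sigma '' S))
    (hb : b ∈ Subgroup.closure (sigma '' T)) : Commute a b := by
  have h1 : Subgroup.closure (sigma '' S) ≤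
      Subgroup.centralizer (Subgroup.closure (sigma '' T) : Set BraidInf) := by
    rw [Subgroup.centralizer_closure, Subgroup.closure_le]
    rintro _ ⟨i, hi, rfl⟩
    rw [SetLike.mem_coe, Subgroup.mem_centralizer_iff]
    rintro _ ⟨j, hj, rfl⟩
    exact (sigma_commute (h i hi j hj)).symm
  exact (Subgroup.mem_centralizer_iff.1 (h1 ha) b hb).symm

theorem shiftedBraidGroup_eq (a n : ℕ) :
    shiftedBraidGroup a n = Subgroup.closure (sigma '' {i | a ≤ i ∧ i + 1 < a + n}) := by
  refine (MonoidHom.map_closure _ _).trans ?_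
  rw [← Set.image_comp]
  congr 1
  ext x
  constructor
  · rintro ⟨i, hi, rfl⟩
    exact ⟨i + a, ⟨by omega, by have : i + 1 < n := hi; omega⟩, (braidShift_pow_sigma a i).symm⟩
  · rintro ⟨i, ⟨hi, hi'⟩, rfl⟩
    refine ⟨i - a, show i - a + 1 < n by omega, (braidShift_pow_sigma a _).trans ?_⟩
    rw [Nat.sub_add_cancel hi]

/-- On generators: all but the topmost commute with the leading letter of `braidDelta (n + 1)`,
which allows induction; the topmost is moved by one braid relation. -/
theorem braidDelta_mul_shift {n : ℕ} {b : BraidInf} (hb : b ∈ braidGroup n) :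
    braidDelta (n + 1) * braidShift b = b * braidDelta (n + 1) := by
  refine mul_eq_mul_of_sigma (f := braidShift) (g := 1) (fun i hi => ?_) hb
  rw [braidShift_sigma]
  change _ = sigma i * _
  have hi : i + 1 < n := hi
  clear hb
  induction n with
  | zero => omega
  | succ n ih =>
    rw [braidDelta_succ]
    rcases Nat.lt_or_ge (i + 1) n with h | h
    · rw [mul_assoc, ih h h, ← mul_assoc, ← mul_assoc, sigma_comm (i := i) (j := n) (by omega)]
    · obtain rfl : n = i + 1 := by omega
      have hc : Commute (braidDelta (i + 1)) (sigma (i + 1)) :=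
        commute_of_mem (T := {i + 1}) (fun a (ha : a + 1 < i + 1) c hc => by
          rw [Set.mem_singleton_iff] at hc; omega) (braidDelta_mem _)
          (Subgroup.subset_closure ⟨_, rfl, rfl⟩)
      rw [braidDelta_succ, mul_assoc, mul_assoc, hc.eq, ← mul_assoc, ← mul_assoc, ← mul_assoc,
        ← mul_assoc, sigma_braid]

/-! ### Injectivity of the shift and location of conjugators. -/

/-- On each `B_n` the shift agrees with conjugation by `δ_{n+1}⁻¹`, and every braid lies in some
`B_n`. -/
theorem braidShift_injective : Function.Injective braidShift := by
  refine (injective_iff_map_eq_one _).2 fun b hb => ?_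
  obtain ⟨n, hn⟩ := exists_mem_braidGroup b
  have := braidDelta_mul_shift hn
  rw [hb, mul_one] at this
  exact mul_eq_right.1 this.symm

theorem mem_braidGroup_of_braidShift_mem {n : ℕ} {b : BraidInf}
    (h : braidShift b ∈ braidGroup (n + 1)) : b ∈ braidGroup n := by
  obtain ⟨m, hm⟩ := exists_mem_braidGroup b
  induction m with
  | zero => exact braidGroup_mono (Nat.zero_le n) hm
  | succ m ih =>
    rcases Nat.lt_or_ge m n with hmn | hmn
    · exact braidGroup_mono hmn hm
    -- Forget strand `m + 1` of `∂b` in two ways. It lies outside `B_{n+1}`, so `∂b` is unchanged;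
    -- it is also the shift of strand `m` of `b`, so the result is `∂b₁` with `b₁ ∈ B_m`.
    -- Injectivity gives `b = b₁`.
    have h1 := strandAction_of_le (i := m + 1) (Nat.succ_le_succ hmn) h
    rw [strandAction_braidShift, Prod.mk.injEq] at h1
    have h2 := strandAction_mem (Nat.lt_succ_self m) hm
    rw [braidShift_injective h1.2] at h2
    exact ih h2.2

theorem mem_braidGroup_of_braidShift_pow_mem {n p : ℕ} {b : BraidInf}
    (h : (braidShift ^ p) b ∈ braidGroup (n + p)) : b ∈ braidGroup n := by
  induction p with
  | zero => exact h
  | succ p ih =>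
    rw [Nat.add_comm p 1, braidShift_pow_add_apply, pow_one, Nat.add_comm 1 p, ← add_assoc] at h
    exact ih (mem_braidGroup_of_braidShift_mem h)

/-- A twisted conjugator between elements of `B_{n+p}` lies in `B_n`. -/
theorem mem_braidGroup_of_twisted_conj {n p : ℕ} (hp : 0 < p) {b z z' : BraidInf}
    (hz : z ∈ braidGroup (n + p)) (hz' : z' ∈ braidGroup (n + p))
    (h : z' = (braidShift ^ p) b⁻¹ * z * b) : b ∈ braidGroup n := by
  obtain ⟨m, hm⟩ := exists_mem_braidGroup b
  induction m with
  | zero => exact braidGroup_mono (Nat.zero_le n) hm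
  | succ m ih =>
    rcases Nat.lt_or_ge m n with hmn | hmn
    · exact braidGroup_mono hmn hm
    -- Since `p ≥ 1`, the factor `b ∈ B_{m+1}` lies in `B_{m+p}`, as do `z` and `z'`; hence so does
    -- `∂^p(b)`, and one strand is gained.
    refine ih (mem_braidGroup_of_braidShift_pow_mem (p := p) ?_)
    have : (braidShift ^ p) b = z * b * z'⁻¹ := by
      rw [h, map_inv]; group
    rw [this]
    have hle : n + p ≤ m + p := by omega
    exact mul_mem (mul_mem (braidGroup_mono hle hz) (braidGroup_mono (by omega) hm))
      (inv_mem (braidGroup_mono hle hz'))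

theorem braidShift_pow_mem_braidGroup {a n m : ℕ} (h : a + n ≤ m) {b : BraidInf}
    (hb : b ∈ braidGroup n) : (braidShift ^ a) b ∈ braidGroup m := by
  have : (braidShift ^ a) b ∈ shiftedBraidGroup a n := ⟨b, hb, rfl⟩
  rw [shiftedBraidGroup_eq] at this
  exact Subgroup.closure_mono
    (Set.image_mono fun i (hi : a ≤ i ∧ i + 1 < a + n) => show i + 1 < m by omega) this

/-! ### Intertwining properties of `τ`. -/

theorem braidTau_succ (p q : ℕ) :
    braidTau p (q + 1) = braidTau p q * (braidShift ^ q) (braidDelta (p + 1)) := by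
  simp [braidTau, List.range_succ]

theorem braidTau_mem (p q : ℕ) : braidTau p q ∈ braidGroup (p + q) := by
  refine list_prod_mem fun x hx => ?_
  simp only [List.mem_map, List.mem_range] at hx
  obtain ⟨i, hi, rfl⟩ := hx
  exact braidShift_pow_mem_braidGroup (by omega) (braidDelta_mem _)

/-- Each of the `q` factors of `τ` absorbs one shift. -/
theorem braidTau_mul_shift {m : ℕ} (q : ℕ) {b : BraidInf} (hb : b ∈ braidGroup m) :
    braidTau m q * (braidShift ^ q) b = b * braidTau m q := by
  induction q with
  | zero => simp [braidTau]
  | succ q ih =>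
    rw [braidTau_succ, braidShift_pow_add_apply, mul_assoc, ← map_mul, pow_one,
      braidDelta_mul_shift hb, map_mul, ← mul_assoc, ih, mul_assoc]

/-- The two-strand case of `braidTau_mul`: two parallel strands pass `m` others and carry their
crossing along. Each additional strand costs one braid relation. -/
theorem braidDelta_mul_braidShift_mul_sigma (m : ℕ) :
    braidDelta (m + 1) * braidShift (braidDelta (m + 1)) * sigma 0 =
      sigma m * (braidDelta (m + 1) * braidShift (braidDelta (m + 1))) := by
  induction m with
  | zero => simp [braidDelta_one]
  | succ m ih =>
    have hc : Commute (braidDelta (m + 1)) (sigma (m + 1)) :=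
      commute_of_mem (T := {m + 1}) (fun a (ha : a + 1 < m + 1) c hc => by
        rw [Set.mem_singleton_iff] at hc; omega) (braidDelta_mem _)
        (Subgroup.subset_closure ⟨_, rfl, rfl⟩)
    have e : braidDelta (m + 2) * braidShift (braidDelta (m + 2)) =
        sigma m * sigma (m + 1) * (braidDelta (m + 1) * braidShift (braidDelta (m + 1))) := by
      rw [braidDelta_succ, map_mul, braidShift_sigma]
      simp only [mul_assoc]
      rw [← mul_assoc (braidDelta (m + 1)), hc.eq, mul_assoc]
    rw [e, mul_assoc, ih, ← mul_assoc, sigma_braid]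
    simp only [mul_assoc]

theorem braidTau_mul {m q : ℕ} {b : BraidInf} (hb : b ∈ braidGroup q) :
    braidTau m q * b = (braidShift ^ m) b * braidTau m q := by
  refine mul_eq_mul_of_sigma (f := 1) (g := braidShift ^ m) (fun i hi => ?_) hb
  rw [braidShift_pow_sigma]
  change _ * sigma i = _
  have hi : i + 1 < q := hi
  clear hb
  have mem : ∀ j, (braidShift ^ j) (braidDelta (m + 1)) ∈ shiftedBraidGroup j (m + 1) :=
    fun j => ⟨_, braidDelta_mem _, rfl⟩
  simp only [shiftedBraidGroup_eq] at mem
  induction q with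
  | zero => omega
  | succ q ih =>
    rcases Nat.lt_or_ge (i + 1) q with h | h
    · have hc : Commute ((braidShift ^ q) (braidDelta (m + 1))) (sigma i) :=
        commute_of_mem (T := {i}) (fun a (ha : q ≤ a ∧ a + 1 < q + (m + 1)) c hc => by
          rw [Set.mem_singleton_iff] at hc; omega) (mem q)
          (Subgroup.subset_closure ⟨_, rfl, rfl⟩)
      rw [braidTau_succ, mul_assoc, hc.eq, ← mul_assoc, ih h h, mul_assoc]
    -- Only the last two factors of `τ` meet `sigma i`; they turn it into `sigma (i + m)`, which
    -- commutes with the earlier factors.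
    · obtain rfl : q = i + 1 := by omega
      have hc : Commute (braidTau m i) (sigma (i + m)) :=
        commute_of_mem (T := {i + m}) (fun a (ha : a + 1 < m + i) c hc => by
          rw [Set.mem_singleton_iff] at hc; omega) (braidTau_mem m i)
          (Subgroup.subset_closure ⟨_, rfl, rfl⟩)
      have key := congrArg (braidShift ^ i) (braidDelta_mul_braidShift_mul_sigma m)
      rw [map_mul, map_mul, map_mul, map_mul, braidShift_pow_sigma, braidShift_pow_sigma,
        Nat.zero_add, Nat.add_comm m i] at key
      rw [braidTau_succ, braidTau_succ, braidShift_pow_add_apply, pow_one, mul_assoc, mul_assoc,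
        ← mul_assoc _ _ (sigma i), key, ← mul_assoc, hc.eq]
      simp only [mul_assoc]

/-! ### The parabolic subgroups -/

theorem coe_sup_of_commute {G : Type*} [Group G] {H K : Subgroup G}
    (h : ∀ a ∈ H, ∀ b ∈ K, Commute a b) : ((H ⊔ K : Subgroup G) : Set G) = H * K := by
  refine Subgroup.coe_mul_of_left_le_normalizer_right H K fun a ha => ?_
  rw [Subgroup.mem_normalizer_iff]
  intro b
  constructor
  · intro hb
    rwa [(h a ha b hb).eq, mul_inv_cancel_right]
  · intro hb
    have := (h a ha _ hb).eq
    rw [mul_assoc, mul_assoc, mul_right_inj, inv_mul_cancel_right] at this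
    rwa [mul_assoc, this] at hb

/-- Indices of the generators of `blockGroup`. -/
def blockSet (p q k : ℕ) : Set ℕ :=
  {i | ∃ j < k, j * p + q ≤ i ∧ i + 1 < j * p + q + (p - q)}

/-- Indices of the generators of `cosetGroup`. -/
def cosetSet (p q₁ q₂ k N : ℕ) : Set ℕ :=
  {i | N - p + q₂ ≤ i ∧ i + 1 < N - p + q₂ + (p - q₂)} ∪ blockSet p q₁ k

theorem blockGroup_eq (p q k : ℕ) :
    blockGroup p q k = Subgroup.closure (sigma '' blockSet p q k) := by
  have : blockSet p q k =
      ⋃ j : Fin k, {i | (j : ℕ) * p + q ≤ i ∧ i + 1 < (j : ℕ) * p + q + (p - q)} := by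
    ext i
    simp only [blockSet, Set.mem_ofPred_eq, Set.mem_iUnion, Fin.exists_iff, exists_prop]
  rw [this, Set.image_iUnion, Subgroup.closure_iUnion]
  exact iSup_congr fun j => shiftedBraidGroup_eq _ _

theorem cosetGroup_eq (p q₁ q₂ k N : ℕ) :
    cosetGroup p q₁ q₂ k N = Subgroup.closure (sigma '' cosetSet p q₁ q₂ k N) := by
  rw [cosetGroup, shiftedBraidGroup_eq, blockGroup_eq, cosetSet, Set.image_union,
    Subgroup.closure_union]

theorem blockSet_lt {p q k i : ℕ} (hq : q ≤ p) (hi : i ∈ blockSet p q k) : i + 1 < k * p := by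
  obtain ⟨j, hj, -, hi⟩ := hi
  have : (j + 1) * p ≤ k * p := Nat.mul_le_mul_right p hj
  rw [Nat.succ_mul] at this
  omega

theorem blockGroup_le {p q k : ℕ} (hq : q ≤ p) : blockGroup p q k ≤ braidGroup (k * p) := by
  rw [blockGroup_eq]
  exact Subgroup.closure_mono (Set.image_mono fun i hi => blockSet_lt hq hi)

/-- Distinct blocks commute, so the ordered elementwise product is already the generated subgroup.
-/
theorem blockProduct_eq {p q : ℕ} (k : ℕ) (hq : 1 ≤ q) (hqp : q ≤ p) :
    blockProduct p q k = (blockGroup p q k : Set BraidInf) := by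
  induction k with
  | zero =>
    rw [blockGroup, iSup_of_empty]
    rfl
  | succ k ih =>
    have h1 : blockProduct p q (k + 1) =
        blockProduct p q k * (shiftedBraidGroup (k * p + q) (p - q) : Set BraidInf) := by
      rw [blockProduct, List.ofFn_succ_last, List.prod_append, List.prod_singleton]
      rfl
    have h2 : blockGroup p q (k + 1) =
        blockGroup p q k ⊔ shiftedBraidGroup (k * p + q) (p - q) := by
      refine le_antisymm (iSup_le fun j => ?_) (sup_le (iSup_le fun j => ?_) ?_)
      · refine Fin.lastCases ?_ (fun j => ?_) j
        · exact le_sup_right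
        · exact le_sup_of_le_left (le_iSup (fun j : Fin k =>
            shiftedBraidGroup ((j : ℕ) * p + q) (p - q)) j)
      · exact le_iSup (fun j : Fin (k + 1) =>
          shiftedBraidGroup ((j : ℕ) * p + q) (p - q)) j.castSucc
      · exact le_iSup (fun j : Fin (k + 1) =>
          shiftedBraidGroup ((j : ℕ) * p + q) (p - q)) (Fin.last k)
    rw [h1, h2, ih, coe_sup_of_commute]
    rw [blockGroup_eq, shiftedBraidGroup_eq]
    -- The first `k` blocks use indices at most `k * p - 2`, while the next one starts at `k * p +
    -- q`.
    refine fun a ha b hb => commute_of_mem (fun i hi j hj => Or.inl ?_) ha hb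
    have := blockSet_lt hqp hi
    have := hj.1
    omega

theorem commute_of_mem_blockGroup {p q₁ q₂ k N : ℕ} (hq₁ : q₁ ≤ p) (hq₂ : 1 ≤ q₂)
    (hN : (k + 1) * p ≤ N) {a b : BraidInf}
    (ha : a ∈ shiftedBraidGroup (N - p + q₂) (p - q₂)) (hb : b ∈ blockGroup p q₁ k) :
    Commute a b := by
  rw [shiftedBraidGroup_eq] at ha
  rw [blockGroup_eq] at hb
  refine commute_of_mem (fun i hi j hj => Or.inr ?_) ha hb
  have := blockSet_lt hq₁ hj
  have := hi.1
  rw [Nat.succ_mul] at hN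
  omega

theorem coe_cosetGroup {p q₁ q₂ k N : ℕ} (hq₁ : 1 ≤ q₁) (hq₁' : q₁ ≤ p) (hq₂ : 1 ≤ q₂)
    (hN : (k + 1) * p ≤ N) : (cosetGroup p q₁ q₂ k N : Set BraidInf) =
      (shiftedBraidGroup (N - p + q₂) (p - q₂) : Set BraidInf) * blockProduct p q₁ k := by
  rw [blockProduct_eq k hq₁ hq₁', cosetGroup, coe_sup_of_commute]
  exact fun a ha b hb => commute_of_mem_blockGroup hq₁' hq₂ hN ha hb

theorem isStandardParabolic_cosetGroup {p q₁ q₂ k N : ℕ} (hq₁ : q₁ ≤ p) (hq₂ : q₂ ≤ p)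
    (hN : (k + 1) * p ≤ N) : IsStandardParabolic N (cosetGroup p q₁ q₂ k N) := by
  refine ⟨_, ?_, cosetGroup_eq p q₁ q₂ k N⟩
  rw [Nat.succ_mul] at hN
  rintro i (hi | hi)
  · have := hi.2
    show i + 1 < N
    omega
  · have := blockSet_lt hq₁ hi
    show i + 1 < N
    omega

theorem isStandardParabolic_braidGroup {m n : ℕ} (h : m ≤ n) :
    IsStandardParabolic n (braidGroup m) :=
  ⟨_, fun i (hi : i + 1 < m) => show i + 1 < n by omega, rfl⟩

/-! ### The reduction -/

theorem BraidWord.isIn_append {P : Subgroup BraidInf} {v w : BraidWord} (hv : v.IsIn P)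
    (hw : w.IsIn P) : IsIn P (v ++ w) :=
  fun l hl => (List.mem_append.1 hl).elim (hv l) (hw l)

theorem BraidWord.isIn_braidGroup_iff {n : ℕ} {w : BraidWord} :
    w.IsIn (braidGroup n) ↔ ∀ l ∈ w, l.1 + 1 < n :=
  ⟨fun h l hl => sigma_mem_closure (S := {i | i + 1 < n}) (h l hl), fun h l hl => sigma_mem_braidGroup (h l hl)⟩

theorem BraidWord.exists_isIn_braidGroup (w : BraidWord) : ∃ n, w.IsIn (braidGroup n) := by
  refine ⟨(w.map fun l => l.1 + 2).sum, isIn_braidGroup_iff.2 fun l hl => ?_⟩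
  exact Nat.lt_of_succ_le (List.le_sum_of_mem (List.mem_map_of_mem (f := fun l => l.1 + 2) hl))

theorem BraidWord.IsIn.mono {P Q : Subgroup BraidInf} (h : P ≤ Q) {w : BraidWord}
    (hw : w.IsIn P) : w.IsIn Q := fun l hl => h (hw l hl)

theorem BraidWord.isIn_shift {n k m : ℕ} {w : BraidWord} (h : n + k ≤ m)
    (hw : w.IsIn (braidGroup n)) : IsIn (braidGroup m) (shift k w) := by
  rw [isIn_braidGroup_iff] at hw ⊢
  intro l hl
  obtain ⟨a, ha, rfl⟩ := List.mem_map.1 hl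
  have := hw a ha
  show a.1 + k + 1 < m
  omega

theorem BraidWord.isIn_inv {P : Subgroup BraidInf} {w : BraidWord} (hw : w.IsIn P) :
    IsIn P (inv w) := by
  intro l hl
  simp only [inv, List.mem_reverse, List.mem_map] at hl
  obtain ⟨m, hm, rfl⟩ := hl
  exact hw m hm

/-- A word for `τ_{m,q}`. -/
def tauWord (m q : ℕ) : BraidWord :=
  (List.range q).flatMap fun j => (List.range m).reverse.map fun i => (i + j, true)

theorem eval_tauWord (m q : ℕ) : (tauWord m q).eval = braidTau m q := by
  rw [tauWord, BraidWord.eval_flatMap, braidTau]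
  congr 1
  refine List.map_congr_left fun j _ => ?_
  rw [braidDelta, map_list_prod]
  simp [BraidWord.eval, Function.comp_def, braidShift_pow_sigma, -Monoid.End.coe_pow]

theorem tauWord_isIn (m q : ℕ) : (tauWord m q).IsIn (braidGroup (m + q)) := by
  rw [BraidWord.isIn_braidGroup_iff]
  intro l hl
  simp only [tauWord, List.mem_flatMap, List.mem_range, List.mem_map, List.mem_reverse] at hl
  obtain ⟨j, hj, i, hi, rfl⟩ := hl
  show i + j + 1 < m + q
  omega

/-- A word for `τ(p,ε)`. -/
def tauSignsWord (p : ℕ) : List Bool → BraidWord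
  | [] => []
  | e :: L => tauSignsWord p L ++
      BraidWord.shift (L.length * p) (bif e then tauWord p p else BraidWord.inv (tauWord p p))

theorem eval_tauSignsWord (p : ℕ) {k : ℕ} (ε : Fin k → Bool) :
    (tauSignsWord p (List.ofFn ε)).eval = braidTauSigns p ε := by
  induction k with
  | zero => rfl
  | succ k ih =>
    -- Signs enter in reverse order: the head `ε 0` of the list governs the last factor, the one
    -- with the largest shift.
    rw [List.ofFn_succ, tauSignsWord, BraidWord.eval_append, BraidWord.eval_shift, ih,
      List.length_ofFn, braidTauSigns, braidTauSigns, List.ofFn_succ_last, List.prod_append,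
      List.prod_singleton, Fin.rev_last, Fin.val_last]
    congr 1
    · congr 2
      funext i
      rw [Fin.rev_castSucc, Fin.val_castSucc]
    · congr 1
      cases ε 0 <;> simp [BraidWord.eval_inv, eval_tauWord]

theorem tauSignsWord_isIn (p : ℕ) (L : List Bool) :
    (tauSignsWord p L).IsIn (braidGroup ((L.length + 1) * p)) := by
  induction L with
  | nil => intro l hl; cases hl
  | cons e L ih =>
    refine BraidWord.isIn_append (ih.mono (braidGroup_mono ?_)) (BraidWord.isIn_shift (n := p + p) ?_ ?_)
    · exact Nat.mul_le_mul_right p (by simp)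
    -- `τ_{p,p}` lies in `B_{2p}`; the shift by `L.length * p` adds up to `(L.length + 2) * p`.
    · rw [List.length_cons]; exact le_of_eq (by ring)
    · cases e
      · exact BraidWord.isIn_inv (tauWord_isIn p p)
      · exact tauWord_isIn p p

/-- The instance of the conjugacy coset problem attached to `N`, the signs and the two words. -/
def sccpInstance (p : ℕ) (d : ℕ × List Bool × BraidWord × BraidWord) : BraidWord × BraidWord :=
  (tauWord (d.1 - p) p ++ d.2.2.2,
    tauWord (d.1 - p) p ++ (tauSignsWord p d.2.1 ++
      BraidWord.shift (d.2.1.length * p) d.2.2.1))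

/-- The letters of index at least `m`, shifted down by `m`. -/
def BraidWord.high (m : ℕ) (w : BraidWord) : BraidWord :=
  w.flatMap fun l => if m ≤ l.1 then [(l.1 - m, l.2)] else []

/-- The letters of index less than `m`. -/
def BraidWord.low (m : ℕ) (w : BraidWord) : BraidWord :=
  w.flatMap fun l => if m ≤ l.1 then [] else [l]

/-- The translation of answers to the conjugacy coset problem. -/
def sccpDecode (p : ℕ) (d : ℕ × BraidWord × BraidWord) : BraidWord × BraidWord × BraidWord :=
  (d.2.2, BraidWord.high (d.1 - p) d.2.1, BraidWord.low (d.1 - p) d.2.1)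

theorem BraidWord.mem_high {m : ℕ} {w : BraidWord} {l : ℕ × Bool} (hl : l ∈ high m w) :
    (l.1 + m, l.2) ∈ w := by
  simp only [high, List.mem_flatMap] at hl
  obtain ⟨a, ha, h⟩ := hl
  split_ifs at h with hm
  · rw [List.mem_singleton] at h
    subst h
    simpa [Nat.sub_add_cancel hm] using ha
  · cases h

theorem BraidWord.mem_low {m : ℕ} {w : BraidWord} {l : ℕ × Bool} (hl : l ∈ low m w) :
    l ∈ w ∧ l.1 < m := by
  simp only [low, List.mem_flatMap] at hl
  obtain ⟨a, ha, h⟩ := hl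
  split_ifs at h with hm
  · cases h
  · rw [List.mem_singleton] at h
    subst h
    exact ⟨ha, not_le.1 hm⟩

/-- With index `m - 1` excluded, every low letter commutes with every high letter, so the high
letters can be collected in front. -/
theorem BraidWord.eval_high_mul_eval_low {m : ℕ} {w : BraidWord}
    (hw : ∀ l ∈ w, m ≤ l.1 ∨ l.1 + 2 ≤ m) :
    (braidShift ^ m) (eval (high m w)) * eval (low m w) = eval w := by
  induction w with
  | nil => simp [high, low]
  | cons l w ih =>
    specialize ih fun a ha => hw a (List.mem_cons_of_mem _ ha)
    rw [eval_cons, ← ih]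
    by_cases hm : m ≤ l.1
    · have h1 : high m (l :: w) = (l.1 - m, l.2) :: high m w := by simp [high, hm]
      have h2 : low m (l :: w) = low m w := by simp [low, hm]
      rw [h1, h2, eval_cons, map_mul, mul_assoc]
      congr 1
      have : (braidShift ^ m) (sigma (l.1 - m)) = sigma l.1 := by
        rw [braidShift_pow_sigma, Nat.sub_add_cancel hm]
      cases l.2 <;>
        simp only [Bool.false_eq_true, if_true, if_false, map_inv (braidShift ^ m), this]
    · have h1 : high m (l :: w) = high m w := by simp [high, hm]
      have h2 : low m (l :: w) = l :: low m w := by simp [low, hm]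
      rw [h1, h2, eval_cons, ← mul_assoc, ← mul_assoc]
      congr 1
      have hl := (hw l List.mem_cons_self).resolve_left hm
      have hmem : (braidShift ^ m) (eval (high m w)) ∈
          Subgroup.closure (sigma '' {i | m ≤ i}) := by
        rw [← eval_shift]
        refine eval_mem fun a ha => ?_
        obtain ⟨a, -, rfl⟩ := List.mem_map.1 ha
        exact Subgroup.subset_closure ⟨_, Nat.le_add_left m a.1, rfl⟩
      have hc : Commute ((braidShift ^ m) (eval (high m w))) (sigma l.1) :=
        commute_of_mem (T := {l.1}) (fun i (hi : m ≤ i) j hj => by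
          rw [Set.mem_singleton_iff] at hj; omega) hmem (Subgroup.subset_closure ⟨_, rfl, rfl⟩)
      split_ifs
      · exact hc.eq
      · exact hc.inv_right.eq

/-! ### Primitive recursiveness -/

theorem primrec_shift : Primrec₂ BraidWord.shift :=
  Primrec.list_map Primrec.snd (Primrec.pair
    (Primrec.nat_add.comp (Primrec.fst.comp Primrec.snd) (Primrec.fst.comp Primrec.fst))
    (Primrec.snd.comp Primrec.snd)).to₂

theorem primrec_tauWord (q : ℕ) : Primrec fun m => tauWord m q := by
  have h : Primrec fun x : ℕ × ℕ => (List.range x.1).reverse.map fun i => (i + x.2, true) :=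
    Primrec.list_map (Primrec.list_reverse.comp (Primrec.list_range.comp Primrec.fst))
      (Primrec.pair (Primrec.nat_add.comp Primrec.snd (Primrec.snd.comp Primrec.fst))
        (Primrec.const true)).to₂
  exact Primrec.list_flatMap (Primrec.const (List.range q)) h.to₂

theorem primrec_tauSignsWord (p : ℕ) : Primrec (tauSignsWord p) := by
  have h : Primrec fun L : List Bool => List.rec (motive := fun _ => BraidWord) []
      (fun e L w => w ++ BraidWord.shift (L.length * p)
        (bif e then tauWord p p else BraidWord.inv (tauWord p p))) L := by
    refine Primrec.list_rec (f := id) (g := fun _ => ([] : BraidWord))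
      (h := fun _ (x : Bool × List Bool × BraidWord) => x.2.2 ++ BraidWord.shift (x.2.1.length * p)
        (bif x.1 then tauWord p p else BraidWord.inv (tauWord p p))) Primrec.id (Primrec.const _) ?_
    refine Primrec.list_append.comp (Primrec.snd.comp (Primrec.snd.comp Primrec.snd))
      (primrec_shift.comp ?_ ?_)
    · exact Primrec.nat_mul.comp (Primrec.list_length.comp
        (Primrec.fst.comp (Primrec.snd.comp Primrec.snd))) (Primrec.const p)
    · exact Primrec.cond (Primrec.fst.comp Primrec.snd) (Primrec.const _) (Primrec.const _)
  refine h.of_eq fun L => ?_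
  induction L with
  | nil => rfl
  | cons e L ih => rw [tauSignsWord, ← ih]

theorem primrec_sccpInstance (p : ℕ) : Primrec (sccpInstance p) := by
  have hτ : Primrec fun d : ℕ × List Bool × BraidWord × BraidWord => tauWord (d.1 - p) p :=
    (primrec_tauWord p).comp (Primrec.nat_sub.comp Primrec.fst (Primrec.const p))
  have hL : Primrec fun d : ℕ × List Bool × BraidWord × BraidWord => d.2.1 :=
    Primrec.fst.comp Primrec.snd
  refine Primrec.pair (Primrec.list_append.comp hτ
    (Primrec.snd.comp (Primrec.snd.comp Primrec.snd))) (Primrec.list_append.comp hτ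
      (Primrec.list_append.comp ((primrec_tauSignsWord p).comp hL) (primrec_shift.comp
        (Primrec.nat_mul.comp (Primrec.list_length.comp hL) (Primrec.const p))
        (Primrec.fst.comp (Primrec.snd.comp Primrec.snd)))))

theorem primrec_high : Primrec₂ BraidWord.high := by
  have h : Primrec fun x : (ℕ × BraidWord) × (ℕ × Bool) =>
      if x.1.1 ≤ x.2.1 then [(x.2.1 - x.1.1, x.2.2)] else [] :=
    Primrec.ite (Primrec.nat_le.comp (Primrec.fst.comp Primrec.fst)
      (Primrec.fst.comp Primrec.snd))
      (Primrec.list_cons.comp (Primrec.pair (Primrec.nat_sub.comp (Primrec.fst.comp Primrec.snd)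
        (Primrec.fst.comp Primrec.fst)) (Primrec.snd.comp Primrec.snd)) (Primrec.const []))
      (Primrec.const [])
  exact Primrec.list_flatMap Primrec.snd h.to₂

theorem primrec_low : Primrec₂ BraidWord.low := by
  have h : Primrec fun x : (ℕ × BraidWord) × (ℕ × Bool) =>
      if x.1.1 ≤ x.2.1 then [] else [x.2] :=
    Primrec.ite (Primrec.nat_le.comp (Primrec.fst.comp Primrec.fst)
      (Primrec.fst.comp Primrec.snd)) (Primrec.const [])
      (Primrec.list_cons.comp Primrec.snd (Primrec.const []))
  exact Primrec.list_flatMap Primrec.snd h.to₂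

theorem primrec_sccpDecode (p : ℕ) : Primrec (sccpDecode p) := by
  have hm : Primrec fun d : ℕ × BraidWord × BraidWord => d.1 - p :=
    Primrec.nat_sub.comp Primrec.fst (Primrec.const p)
  have hw : Primrec fun d : ℕ × BraidWord × BraidWord => d.2.1 := Primrec.fst.comp Primrec.snd
  exact Primrec.pair (Primrec.snd.comp Primrec.snd)
    (Primrec.pair (primrec_high.comp hm hw) (primrec_low.comp hm hw))

/-! ### Correctness of the reduction -/

theorem eval_sccpInstance_fst (p N : ℕ) (L : List Bool) (w w' : BraidWord) :
    (sccpInstance p (N, L, w, w')).1.eval = braidTau (N - p) p * w'.eval := by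
  rw [sccpInstance, BraidWord.eval_append, eval_tauWord]

theorem eval_sccpInstance_snd (p N : ℕ) {k : ℕ} (ε : Fin k → Bool) (w w' : BraidWord) :
    (sccpInstance p (N, List.ofFn ε, w, w')).2.eval =
      braidTau (N - p) p * (braidTauSigns p ε * (braidShift ^ (k * p)) w.eval) := by
  rw [sccpInstance, BraidWord.eval_append, eval_tauWord, BraidWord.eval_append,
    eval_tauSignsWord, BraidWord.eval_shift, List.length_ofFn]

theorem sccpInstance_isIn {p k N : ℕ} (hN : (k + 1) * p ≤ N) {w w' : BraidWord}
    (hw : w.IsIn (braidGroup (N - k * p))) (hw' : w'.IsIn (braidGroup N)) (ε : Fin k → Bool) :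
    BraidWord.IsIn (braidGroup N) (sccpInstance p (N, List.ofFn ε, w, w')).1 ∧
      BraidWord.IsIn (braidGroup N) (sccpInstance p (N, List.ofFn ε, w, w')).2 := by
  have hN' := hN
  rw [Nat.succ_mul] at hN'
  have hτ : (tauWord (N - p) p).IsIn (braidGroup N) :=
    (tauWord_isIn (N - p) p).mono (braidGroup_mono (by omega))
  refine ⟨BraidWord.isIn_append hτ hw', BraidWord.isIn_append hτ (BraidWord.isIn_append ?_ ?_)⟩
  · refine (tauSignsWord_isIn p _).mono (braidGroup_mono ?_)
    rwa [List.length_ofFn]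
  · refine BraidWord.isIn_shift ?_ hw
    rw [List.length_ofFn]
    omega

/-- Conjugation by `c` turns `τ_{m,p} s'` into the prescribed element of the coset exactly when
`c` is the conjugator of the decomposition. -/
theorem conj_iff_decomposition {m p q₁ q₂ k : ℕ} (hq₁ : q₁ ≤ p) (hq₂ : q₂ ≤ p)
    (hm : k * p ≤ m) {c β' β'' z s' : BraidInf} (hc : c ∈ braidGroup m)
    (hβ' : β' ∈ shiftedBraidGroup q₂ (p - q₂)) (hβ'' : β'' ∈ blockGroup p q₁ k) :
    c * (braidTau m p * s') * c⁻¹ = (braidShift ^ m) β' * β'' * (braidTau m p * z) ↔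
      s' = (braidShift ^ p) c⁻¹ * β' * (braidShift ^ p) β'' * z * c := by
  have h1 := braidTau_mul_shift p hc
  have h2 : braidTau m p * β' = (braidShift ^ m) β' * braidTau m p := by
    refine braidTau_mul ?_
    rw [shiftedBraidGroup_eq] at hβ'
    exact Subgroup.closure_mono (Set.image_mono fun i (hi : q₂ ≤ i ∧ i + 1 < q₂ + (p - q₂)) =>
      show i + 1 < p by omega) hβ'
  have h3 := braidTau_mul_shift p (braidGroup_mono hm (blockGroup_le hq₁ hβ''))
  have e1 : c * (braidTau m p * s') * c⁻¹ = braidTau m p * ((braidShift ^ p) c * s' * c⁻¹) := by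
    rw [← mul_assoc c, ← h1]
    simp only [mul_assoc]
  have e2 : (braidShift ^ m) β' * β'' * (braidTau m p * z) =
      braidTau m p * (β' * ((braidShift ^ p) β'' * z)) := by
    rw [← mul_assoc, mul_assoc _ β'', ← h3, ← mul_assoc, ← h2]
    simp only [mul_assoc]
  rw [e1, e2, mul_right_inj, map_inv]
  constructor
  · intro h
    rw [mul_inv_eq_iff_eq_mul, ← eq_inv_mul_iff_mul_eq] at h
    rw [h]
    simp only [mul_assoc]
  · rintro h
    rw [h]
    group

theorem shift_mem_shiftedBraidGroup {m q n : ℕ} {b : BraidInf}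
    (hb : b ∈ shiftedBraidGroup q n) : (braidShift ^ m) b ∈ shiftedBraidGroup (m + q) n := by
  obtain ⟨a, ha, rfl⟩ := hb
  exact ⟨a, ha, braidShift_pow_add_apply m q a⟩

/-- Splitting at index `N - p` separates the two factors of `H`: block letters have index at most `k
* p - 2`, and `k * p ≤ N - p`, whereas the other generators start at `N - p + q₂`. -/
theorem decompositionAnswer_of_sccpAnswer {p q₁ q₂ k N : ℕ} (hq₁ : 1 ≤ q₁) (hq₁' : q₁ ≤ p)
    (hq₂' : q₂ ≤ p) (hN : (k + 1) * p ≤ N) {w w' : BraidWord} (ε : Fin k → Bool)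
    {a : BraidWord × BraidWord} (ha : SCCPAnswer (cosetGroup p q₁ q₂ k N) (braidGroup (N - p))
      (sccpInstance p (N, List.ofFn ε, w, w')) a) :
    DecompositionAnswer p q₁ q₂ w w' ε (sccpDecode p (N, a)) := by
  obtain ⟨hH, hK, -, hc, h⟩ := ha
  rw [Nat.succ_mul] at hN
  have hset : ∀ l ∈ a.1, l.1 ∈ cosetSet p q₁ q₂ k N := fun l hl =>
    sigma_mem_closure (cosetGroup_eq p q₁ q₂ k N ▸ hH l hl)
  have hlow : (BraidWord.low (N - p) a.1).IsIn (blockGroup p q₁ k) := by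
    intro l hl
    obtain ⟨hl, hlt⟩ := BraidWord.mem_low hl
    rcases hset l hl with h | h
    · have := h.1
      omega
    · rw [blockGroup_eq]
      exact Subgroup.subset_closure ⟨_, h, rfl⟩
  have hhigh : (BraidWord.high (N - p) a.1).IsIn (shiftedBraidGroup q₂ (p - q₂)) := by
    intro l hl
    rw [shiftedBraidGroup_eq]
    refine Subgroup.subset_closure ⟨_, ?_, rfl⟩
    rcases hset _ (BraidWord.mem_high hl) with h | h
    · have h1 : N - p + q₂ ≤ l.1 + (N - p) := h.1
      have h2 : l.1 + (N - p) + 1 < N - p + q₂ + (p - q₂) := h.2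
      exact ⟨by omega, by omega⟩
    · have : l.1 + (N - p) + 1 < k * p := blockSet_lt hq₁' h
      omega
  refine ⟨hhigh, hlow, BraidWord.eval_mem hhigh, ?_, ?_⟩
  · rw [blockProduct_eq k hq₁ hq₁']
    exact BraidWord.eval_mem hlow
  · rw [eval_sccpInstance_fst, eval_sccpInstance_snd,
      ← BraidWord.eval_high_mul_eval_low (m := N - p) (w := a.1) ?_,
      conj_iff_decomposition hq₁' hq₂' (by omega) hc (BraidWord.eval_mem hhigh)
        (BraidWord.eval_mem hlow)] at h
    · simpa only [sccpDecode, mul_assoc] using h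
    · intro l hl
      rcases hset l hl with h | h
      · have := h.1
        exact Or.inl (by omega)
      · have := blockSet_lt hq₁' h
        exact Or.inr (by omega)

/-- The given `b` itself serves as conjugator once it is known to lie in `B_{N-p}`; this is where
the bounds on the input words are used. -/
theorem sccp_of_decomposition {p q₁ q₂ k N : ℕ} (hq₁ : 1 ≤ q₁) (hq₁' : q₁ ≤ p)
    (hq₂' : q₂ ≤ p) (hN : (k + 1) * p ≤ N) {w w' : BraidWord}
    (hw : w.IsIn (braidGroup (N - k * p))) (hw' : w'.IsIn (braidGroup N)) {ε : Fin k → Bool}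
    {b β' β'' : BraidInf} (h : IsDecomposition p q₁ q₂ w.eval w'.eval ε b β' β'') :
    IsSCCPInput (braidGroup N) (cosetGroup p q₁ q₂ k N)
        (sccpInstance p (N, List.ofFn ε, w, w')).1.eval
        (sccpInstance p (N, List.ofFn ε, w, w')).2.eval ∧
      ∃ a : BraidWord × BraidWord, SCCPAnswer (cosetGroup p q₁ q₂ k N) (braidGroup (N - p))
        (sccpInstance p (N, List.ofFn ε, w, w')) a := by
  obtain ⟨hβ', hβ'', h⟩ := h
  rw [blockProduct_eq k hq₁ hq₁'] at hβ''
  obtain ⟨hx, hy⟩ := sccpInstance_isIn hN hw hw' ε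
  have hN' := hN
  rw [Nat.succ_mul] at hN'
  rcases Nat.eq_zero_or_pos p with rfl | hp
  · omega
  -- All factors of the equation other than `b` and `∂^p(b⁻¹)` lie in `B_N`, so `b` is a twisted
  -- conjugator between elements of `B_N`.
  have hb : b ∈ braidGroup (N - p) := by
    refine mem_braidGroup_of_twisted_conj (p := p) hp
      (z := β' * (braidShift ^ p) β'' * braidTauSigns p ε * (braidShift ^ (k * p)) w.eval)
      (z' := w'.eval) ?_ ?_ (by rw [h]; simp only [mul_assoc])
    · rw [Nat.sub_add_cancel (by omega)]
      refine mul_mem (mul_mem (mul_mem ?_ ?_) ?_) ?_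
      · obtain ⟨g, hg, rfl⟩ := hβ'
        exact braidShift_pow_mem_braidGroup (by omega) hg
      · exact braidShift_pow_mem_braidGroup (by omega) (blockGroup_le hq₁' hβ'')
      · have := BraidWord.eval_mem (tauSignsWord_isIn p (List.ofFn ε))
        rw [eval_tauSignsWord, List.length_ofFn] at this
        exact braidGroup_mono hN this
      · exact braidShift_pow_mem_braidGroup (by omega) (BraidWord.eval_mem hw)
    · rw [Nat.sub_add_cancel (by omega)]
      exact BraidWord.eval_mem hw'
  have hmem : (braidShift ^ (N - p)) β' * β'' ∈ cosetGroup p q₁ q₂ k N :=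
    mul_mem (Subgroup.mem_sup_left (shift_mem_shiftedBraidGroup hβ')) (Subgroup.mem_sup_right hβ'')
  have hconj : b * (sccpInstance p (N, List.ofFn ε, w, w')).1.eval * b⁻¹ =
      (braidShift ^ (N - p)) β' * β'' * (sccpInstance p (N, List.ofFn ε, w, w')).2.eval := by
    rw [eval_sccpInstance_fst, eval_sccpInstance_snd,
      conj_iff_decomposition hq₁' hq₂' (by omega) hb hβ' hβ'', h]
    simp only [mul_assoc]
  refine ⟨⟨BraidWord.eval_mem hx, BraidWord.eval_mem hy, b, braidGroup_mono (Nat.sub_le N p) hb,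
    _, hmem, hconj⟩, ?_⟩
  have hmem' := hmem
  rw [cosetGroup_eq] at hmem'
  obtain ⟨u, hu, hue⟩ := BraidWord.exists_isIn_eval_eq hmem'
  obtain ⟨v, hv, hve⟩ := BraidWord.exists_isIn_eval_eq hb
  rw [← cosetGroup_eq] at hu
  refine ⟨(u, v), hu, hv, ?_⟩
  rw [hue, hve]
  exact ⟨hmem, hb, hconj⟩

theorem proposition5p1 (p q₁ q₂ : ℕ) (hq₁ : 1 < q₁) (hq₁₂ : q₁ < q₂) (hq₂ : q₂ < p)
    (hq₁' : 3 ≤ q₁) (hq₂' : 3 ≤ p - q₂) :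
    -- the subgroups are standard parabolic in `B_N`, and `H` is the product of its factors
    (∀ k N : ℕ, (k + 1) * p ≤ N →
      IsStandardParabolic N (cosetGroup p q₁ q₂ k N) ∧
      IsStandardParabolic N (braidGroup (N - p)) ∧
      (cosetGroup p q₁ q₂ k N : Set BraidInf) =
        (shiftedBraidGroup (N - p + q₂) (p - q₂) : Set BraidInf) * blockProduct p q₁ k) ∧
    -- every sufficiently large `N` is admissible below
    (∀ (k : ℕ) (w w' : BraidWord), ∃ N₀ : ℕ, ∀ N : ℕ, N₀ ≤ N →
      (k + 1) * p ≤ N ∧ BraidWord.IsIn (braidGroup (N - k * p)) w ∧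
        BraidWord.IsIn (braidGroup N) w') ∧
    -- the reduction: `inst` produces one instance for each sign vector, `dec` translates answers
    ∃ (inst : ℕ × List Bool × BraidWord × BraidWord → BraidWord × BraidWord)
      (dec : ℕ × BraidWord × BraidWord → BraidWord × BraidWord × BraidWord),
      Primrec inst ∧ Primrec dec ∧
      ∀ (k N : ℕ) (w w' : BraidWord), (k + 1) * p ≤ N →
        BraidWord.IsIn (braidGroup (N - k * p)) w → BraidWord.IsIn (braidGroup N) w' →
        -- the number of instances
        Fintype.card (Fin k → Bool) = 2 ^ k ∧
        -- every instance consists of two elements of `B_N`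
        (∀ ε : Fin k → Bool,
          BraidWord.IsIn (braidGroup N) (inst (N, List.ofFn ε, w, w')).1 ∧
          BraidWord.IsIn (braidGroup N) (inst (N, List.ofFn ε, w, w')).2) ∧
        -- every solution of every instance yields a solution of the decomposition problem
        (∀ (ε : Fin k → Bool) (a : BraidWord × BraidWord),
          SCCPAnswer (cosetGroup p q₁ q₂ k N) (braidGroup (N - p))
            (inst (N, List.ofFn ε, w, w')) a →
          DecompositionAnswer p q₁ q₂ w w' ε (dec (N, a))) ∧
        -- if the decomposition problem is solvable with signs `ε`, so is the instance of `ε`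
        (∀ ε : Fin k → Bool,
          (∃ b β' β'' : BraidInf, IsDecomposition p q₁ q₂ w.eval w'.eval ε b β' β'') →
          IsSCCPInput (braidGroup N) (cosetGroup p q₁ q₂ k N)
            (BraidWord.eval (inst (N, List.ofFn ε, w, w')).1)
            (BraidWord.eval (inst (N, List.ofFn ε, w, w')).2) ∧
          ∃ a : BraidWord × BraidWord,
            SCCPAnswer (cosetGroup p q₁ q₂ k N) (braidGroup (N - p))
              (inst (N, List.ofFn ε, w, w')) a) ∧
        -- hence solving the instances (those that are solvable) solves the decomposition problem
        (IsDecompositionInput p q₁ q₂ k w.eval w'.eval →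
          ∀ F : (Fin k → Bool) → BraidWord × BraidWord,
            (∀ ε : Fin k → Bool,
              (∃ a : BraidWord × BraidWord,
                SCCPAnswer (cosetGroup p q₁ q₂ k N) (braidGroup (N - p))
                  (inst (N, List.ofFn ε, w, w')) a) →
              SCCPAnswer (cosetGroup p q₁ q₂ k N) (braidGroup (N - p))
                (inst (N, List.ofFn ε, w, w')) (F ε)) →
            ∃ ε : Fin k → Bool,
              SCCPAnswer (cosetGroup p q₁ q₂ k N) (braidGroup (N - p))
                (inst (N, List.ofFn ε, w, w')) (F ε) ∧
              DecompositionAnswer p q₁ q₂ w w' ε (dec (N, F ε))) := by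
  have hq₁p : q₁ ≤ p := by omega
  refine ⟨fun k N hN => ⟨isStandardParabolic_cosetGroup hq₁p hq₂.le hN,
    isStandardParabolic_braidGroup (Nat.sub_le N p),
    coe_cosetGroup hq₁.le hq₁p (by omega) hN⟩, fun k w w' => ?_,
    sccpInstance p, sccpDecode p, primrec_sccpInstance p, primrec_sccpDecode p,
    fun k N w w' hN hw hw' => ?_⟩
  · obtain ⟨n, hn⟩ := w.exists_isIn_braidGroup
    obtain ⟨n', hn'⟩ := w'.exists_isIn_braidGroup
    refine ⟨(k + 1) * p + n + n', fun N hN => ?_⟩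
    rw [Nat.succ_mul] at hN ⊢
    exact ⟨by omega, hn.mono (braidGroup_mono (by omega)), hn'.mono (braidGroup_mono (by omega))⟩
  · have sound := fun (ε : Fin k → Bool) (a : BraidWord × BraidWord) =>
      decompositionAnswer_of_sccpAnswer (q₂ := q₂) (w := w) (w' := w') (a := a)
        hq₁.le hq₁p hq₂.le hN ε
    have complete : ∀ ε : Fin k → Bool, (∃ b β' β'' : BraidInf,
        IsDecomposition p q₁ q₂ w.eval w'.eval ε b β' β'') → _ :=
      fun ε ⟨b, β', β'', h⟩ => sccp_of_decomposition hq₁.le hq₁p hq₂.le hN hw hw' h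
    refine ⟨by simp, sccpInstance_isIn hN hw hw', sound, complete, ?_⟩
    -- The sign vector of the hidden solution is the one whose instance is certainly solvable; as it
    -- is not known beforehand, all `2 ^ k` are tried.
    rintro ⟨ε, h⟩ F hF
    have hε := hF ε (complete ε h).2
    exact ⟨ε, hε, sound ε _ hε⟩
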